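/- Conventions. A function on $\mathbb C$ is *real* if it maps $\mathbb R$ into $\mathbb R$. An entire function or polynomial is *hyperbolic* if all of its complex zeros are real; the zero polynomial is also counted as hyperbolic. An entire function $f\not\equiv 0$ has *genus at most $1$* if $$f(z)=C\,z^m e^{bz}\prod_k\Bigl(1-\frac{z}{\rho_k}\Bigr)e^{z/\rho_k}$$ with $C,b\in\mathbb C$, $C\neq 0$, $m\in\mathbb Z_{\ge 0}$, and a finite or countably infinite (possibly empty) family of nonzero complex numbers $\rho_k$ satisfying $\sum_k|\rho_k|^{-2}<\infty$. A function is of *genus $1^*$* if it has the form $e^{-\alpha z^2}f(z)$ with $\alpha\ge 0$ real and $f$ entire of genus at most $1$ (so it is not identically zero). The *Laguerre–Pólya class* consists of the real entire functions of genus $1^*$ that have only real zeros. For $\Omega(z)=\sum_{j\ge 0}a_j z^j/j!$ and $d\ge 0$, the *reciprocal Jensen polynomial* is $$g^*_d(\Omega;x)=\sum_{j=0}^{d}\binom dj a_j\,x^{d-j}.$$ Theorem 3.5. Let $\Phi(z)=\sum_{j=0}^\infty c_j z^j/j!$ be a real entire function of genus $1^*$, and let $\Omega$ be in the Laguerre–Pólya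 class. Then $\Phi$ is hyperbolic if and only if, for every integer $d\ge 1$, the polynomial $$\sum_{j=0}^{d}\binom dj c_j\, g^*_{d-j}(\Omega;x)$$ is hyperbolic. -/

import Mathlib

open Polynomial

noncomputable section

namespace LaguerrePolya

/-- A function is hyperbolic if all of its zeros are real. The function that vanishes identically
is counted as hyperbolic: polynomials attached to a series with vanishing low order terms may
be the zero polynomial. -/
def IsHyperbolic (f : ℂ → ℂ) : Prop :=
  f = 0 ∨ ∀ z : ℂ, f z = 0 → z.im = 0

/-- A function is real if it maps the real line into the real line. -/
def IsReal (f : ℂ → ℂ) : Prop :=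
  ∀ x : ℝ, (f x).im = 0

/-- Entire functions of genus at most one: those with a Hadamard factorization
`f z = C * z ^ m * exp (b * z) * ∏ₖ (1 - z / ρₖ) * exp (z / ρₖ)`, where `C ≠ 0`, the nonzero zeros
`ρₖ` are listed with multiplicity (a finite or countable family), and `∑ₖ 1 / |ρₖ| ^ 2 < ∞`.
Summability forces `ι` to be countable and makes the product converge absolutely.
Genus zero is included: if `∑ₖ 1 / |ρₖ| < ∞` then the factors `exp (z / ρₖ)` can be absorbed
into `exp (b * z)`. The zero function has no genus and is not included. -/
def HasGenusAtMostOne (f : ℂ → ℂ) : Prop :=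
  Differentiable ℂ f ∧
  ∃ (C b : ℂ) (m : ℕ) (ι : Type) (ρ : ι → ℂ) (P : ℂ → ℂ),
    C ≠ 0 ∧ (∀ k, ρ k ≠ 0) ∧ Summable (fun k => (‖ρ k‖ ^ 2)⁻¹) ∧
    (∀ z, HasProd (fun k => (1 - z / ρ k) * Complex.exp (z / ρ k)) (P z)) ∧
    ∀ z, f z = C * z ^ m * Complex.exp (b * z) * P z

/-- Functions of genus `1*`: those of the form `exp (-α z ^ 2) f z` with `α ≥ 0` real and `f`
entire of genus at most one. -/
def HasGenusOneStar (F : ℂ → ℂ) : Prop :=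
  ∃ (α : ℝ) (f : ℂ → ℂ), 0 ≤ α ∧ HasGenusAtMostOne f ∧
    ∀ z, F z = Complex.exp (-(α : ℂ) * z ^ 2) * f z

/-- The Laguerre–Pólya class: real entire functions of genus `1*` with only real zeros. -/
def IsLaguerrePolya (F : ℂ → ℂ) : Prop :=
  IsReal F ∧ HasGenusOneStar F ∧ IsHyperbolic F

/-- The reciprocal Jensen polynomial `∑ⱼ (d choose j) aⱼ X ^ (d - j)` of degree `d` associated to
`F z = ∑ⱼ aⱼ z ^ j / j!`; here `aⱼ` is the `j`-th derivative of `F` at `0`. -/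
def reciprocalJensen (d : ℕ) (F : ℂ → ℂ) : ℂ[X] :=
  ∑ j ∈ Finset.range (d + 1), C ((d.choose j : ℂ) * iteratedDeriv j F 0) * X ^ (d - j)

end LaguerrePolya

end

open Filter Topology

namespace LaguerrePolya

/-! By Leibniz, the polynomials in question are the reciprocal Jensen polynomials of the product `Φ
* Ω` (`sum_reciprocalJensen_eq`), so everything reduces to that one entire function.

If `Φ` is hyperbolic, both factors are Laguerre–Pólya, hence locally uniform limits of real-rooted
polynomials (`IsLaguerrePolya.mem_closure`). Such limits form a submonoid, which therefore contains
the product. For a polynomial `p` the reciprocal Jensen polynomial is `p(D) x ^ d`, and `p(D)` with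
`p` real-rooted preserves hyperbolicity (`IsHyperbolic.aeval_derivative`). Its coefficients depend
on finitely many Taylor coefficients, so Hurwitz carries this to the limit.

Conversely, reversing and rescaling the reciprocal Jensen polynomials gives Jensen polynomials,
which converge to `Φ * Ω`. Hurwitz makes the product hyperbolic. It is not identically zero, and
every zero of `Φ` is one of its zeros. -/

/-! ### Locally uniform convergence -/

/-- **Hurwitz**: hyperbolicity passes to locally uniform limits of entire functions. -/
theorem IsHyperbolic.of_tendstoLocallyUniformlyOn {ι : Type*} {l : Filter ι} [l.NeBot]
    {F : ι → ℂ → ℂ} {f : ℂ → ℂ} (hF : ∀ᶠ n in l, Differentiable ℂ (F n))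
    (hyp : ∀ᶠ n in l, IsHyperbolic (F n))
    (h : TendstoLocallyUniformlyOn F f l Set.univ) : IsHyperbolic f := by
  by_contra hf
  simp only [IsHyperbolic, not_or, not_forall] at hf
  obtain ⟨hf0, z₀, hz₀, him⟩ := hf
  have hd : Differentiable ℂ f := differentiableOn_univ.1
    (h.differentiableOn (hF.mono fun n hn => hn.differentiableOn) isOpen_univ)
  have hne : ∀ᶠ z in 𝓝[≠] z₀, f z ≠ 0 := by
    refine (hd.analyticAt z₀).eventually_eq_zero_or_eventually_ne_zero.resolve_left fun h0 => hf0 ?_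
    exact AnalyticOnNhd.eq_of_eventuallyEq (z₀ := z₀) (fun z _ => hd.analyticAt z)
      (fun z _ => analyticAt_const) h0
  have him' : ∀ᶠ z in 𝓝 z₀, z.im ≠ 0 := Complex.continuous_im.continuousAt.eventually_ne him
  rw [eventually_nhdsWithin_iff] at hne
  obtain ⟨R, hR, hball⟩ := Metric.eventually_nhds_iff.1 (hne.and him')
  set r := R / 2 with hr
  have hr0 : 0 < r := by positivity
  have hlt : ∀ z ∈ Metric.closedBall z₀ r, dist z z₀ < R := fun z hz =>
    lt_of_le_of_lt (Metric.mem_closedBall.1 hz) (by linarith)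
  have hsph : ∀ z ∈ Metric.sphere z₀ r, f z ≠ 0 := fun z hz =>
    (hball (hlt z (Metric.sphere_subset_closedBall hz))).1 (Metric.ne_of_mem_sphere hz hr0.ne')
  have hSne : (Metric.sphere z₀ r).Nonempty := NormedSpace.sphere_nonempty.2 hr0.le
  obtain ⟨w, hw, hmin⟩ := (isCompact_sphere z₀ r).exists_isMinOn hSne
    (hd.continuous.norm.continuousOn)
  have hm : 0 < ‖f w‖ := norm_pos_iff.2 (hsph w hw)
  have hunif := (tendstoLocallyUniformlyOn_iff_forall_isCompact isOpen_univ).1 h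
    (Metric.closedBall z₀ r) (Set.subset_univ _) (isCompact_closedBall z₀ r)
  rw [Metric.tendstoUniformlyOn_iff] at hunif
  obtain ⟨n, hn, hnh, hnd⟩ :=
    ((hunif (‖f w‖ / 4) (by positivity)).and (hyp.and hF)).exists
  have hlow : ∀ z ∈ Metric.sphere z₀ r, ‖f w‖ / 2 ≤ ‖F n z‖ := by
    intro z hz
    have h1 := hn z (Metric.sphere_subset_closedBall hz)
    rw [dist_eq_norm] at h1
    have h2 : ‖f w‖ ≤ ‖f z‖ := hmin hz
    have h3 := norm_sub_norm_le (f z) (F n z)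
    linarith
  have hFn : F n ≠ 0 := by
    intro h0
    have := hlow w hw
    simp only [h0, Pi.zero_apply, norm_zero] at this
    linarith
  have hnz : ∀ z ∈ Metric.closedBall z₀ r, F n z ≠ 0 := fun z hz h0 =>
    (hball (hlt z hz)).2 (hnh.resolve_left hFn z h0)
  have hz0c : z₀ ∈ Metric.closedBall z₀ r := Metric.mem_closedBall_self hr0.le
  -- Maximum principle for `1 / F n`, which has no pole in the disc: the lower bound for `‖F n‖` on
  -- the circle also holds at the centre, where `F n` is close to `f z₀ = 0`.
  have hmax : ‖(F n z₀)⁻¹‖ ≤ (‖f w‖ / 2)⁻¹ := by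
    refine Complex.norm_le_of_forall_mem_frontier_norm_le (f := fun z => (F n z)⁻¹)
      (Metric.isBounded_ball (x := z₀) (r := r)) ?_ ?_ (subset_closure (Metric.mem_ball_self hr0))
    · refine hnd.diffContOnCl.inv fun z hz => hnz z ?_
      rwa [closure_ball _ hr0.ne'] at hz
    · intro z hz
      rw [frontier_ball _ hr0.ne'] at hz
      rw [norm_inv]
      exact inv_anti₀ (by positivity) (hlow z hz)
  rw [norm_inv, inv_le_inv₀ (norm_pos_iff.2 (hnz z₀ hz0c)) (by positivity)] at hmax
  have h1 := hn z₀ hz0c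
  rw [hz₀, dist_zero_left] at h1
  linarith

/-- Locally uniform convergence of entire functions passes to all derivatives. -/
theorem tendstoLocallyUniformlyOn_iteratedDeriv {ι : Type*} {l : Filter ι}
    {F : ι → ℂ → ℂ} {f : ℂ → ℂ} (hF : ∀ᶠ n in l, Differentiable ℂ (F n))
    (h : TendstoLocallyUniformlyOn F f l Set.univ) (k : ℕ) :
    TendstoLocallyUniformlyOn (fun n => iteratedDeriv k (F n)) (iteratedDeriv k f) l
      Set.univ := by
  induction k with
  | zero => simpa using h
  | succ k ih =>
    simp only [iteratedDeriv_succ]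
    refine ih.deriv (hF.mono fun n hn => ?_) isOpen_univ
    have hc : ContDiff ℂ ⊤ (F n) := hn.contDiff
    exact (hc.differentiable_iteratedDeriv k (WithTop.coe_lt_top _)).differentiableOn

/-- The Jensen polynomials `∑ₖ (d choose k) eₖ (z / d) ^ k` of an entire function
`f z = ∑ₖ eₖ z ^ k / k!` converge to it locally uniformly. -/
theorem tendstoLocallyUniformlyOn_jensen {e : ℕ → ℂ} {f : ℂ → ℂ}
    (hf : ∀ z : ℂ, HasSum (fun k : ℕ => e k * z ^ k / (k.factorial : ℂ)) (f z)) :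
    TendstoLocallyUniformlyOn
      (fun (d : ℕ) (z : ℂ) => ∑ k ∈ Finset.range (d + 1), (d.choose k : ℂ) * e k * (z / d) ^ k)
      f atTop Set.univ := by
  rw [tendstoLocallyUniformlyOn_iff_forall_isCompact isOpen_univ]
  intro K _ hK
  obtain ⟨R, hR⟩ := hK.isBounded.subset_closedBall (0 : ℂ)
  set R' : ℝ := max R 0
  have hR' : ∀ z ∈ K, ‖z‖ ≤ R' := fun z hz =>
    (mem_closedBall_zero_iff.1 (hR hz)).trans (le_max_left _ _)
  have hR0 : 0 ≤ R' := le_max_right _ _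
  -- `w d k` is the ratio of the `k`-th Jensen term to the `k`-th Taylor term. It lies in `[0, 1]`
  -- and tends to `1`, so dominated convergence applies.
  set w : ℕ → ℕ → ℝ := fun d k => (d.descFactorial k : ℝ) / (d : ℝ) ^ k with hw
  have hw0 : ∀ d k, 0 ≤ w d k := fun d k => by positivity
  have hw1 : ∀ d k, w d k ≤ 1 := fun d k => by
    refine div_le_one_of_le₀ ?_ (by positivity)
    exact_mod_cast Nat.descFactorial_le_pow d k
  have hwt : ∀ k, Tendsto (fun d => w d k) atTop (𝓝 1) := fun k => by
    have hz : ∀ᶠ d : ℕ in atTop, (d : ℝ) ^ k ≠ 0 :=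
      eventually_atTop.mpr ⟨1, fun n hn => by positivity⟩
    exact (Asymptotics.isEquivalent_iff_tendsto_one hz).1 (isEquivalent_descFactorial k)
  set b : ℕ → ℝ := fun k => ‖e k‖ * R' ^ k / (k.factorial : ℝ) with hb
  have hbs : Summable b := by
    have := (hf R').summable.norm
    simpa [hb, abs_of_nonneg hR0] using this
  have hb0 : ∀ k, 0 ≤ b k := fun k => by positivity
  have hterm : ∀ d k, ‖b k * (1 - w d k)‖ ≤ b k := fun d k => by
    rw [Real.norm_of_nonneg (mul_nonneg (hb0 k) (sub_nonneg.2 (hw1 d k)))]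
    exact mul_le_of_le_one_right (hb0 k) (by linarith [hw0 d k])
  have hlim : Tendsto (fun d => ∑' k, b k * (1 - w d k)) atTop (𝓝 0) := by
    have := tendsto_tsum_of_dominated_convergence (𝓕 := atTop)
      (f := fun d k => b k * (1 - w d k)) (g := fun _ => 0) hbs
      (fun k => by simpa using ((hwt k).const_sub 1).const_mul (b k))
      (Eventually.of_forall fun d k => hterm d k)
    simpa using this
  rw [Metric.tendstoUniformlyOn_iff]
  intro ε hε
  filter_upwards [hlim.eventually_lt_const hε] with d hd z hz
  refine lt_of_le_of_lt ?_ hd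
  have hfin : HasSum (fun k => e k * z ^ k / (k.factorial : ℂ) * (w d k : ℂ))
      (∑ k ∈ Finset.range (d + 1), (d.choose k : ℂ) * e k * (z / d) ^ k) := by
    have : ∀ k, e k * z ^ k / (k.factorial : ℂ) * (w d k : ℂ)
        = (d.choose k : ℂ) * e k * (z / d) ^ k := fun k => by
      have hk : (k.factorial : ℂ) ≠ 0 := by exact_mod_cast k.factorial_ne_zero
      simp only [hw, Nat.descFactorial_eq_factorial_mul_choose, div_pow]
      push_cast
      rw [div_mul_div_comm, ← mul_div_assoc, mul_comm, mul_div_mul_comm]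
      field_simp
    simp only [this]
    refine hasSum_sum_of_ne_finset_zero fun k hk => ?_
    rw [Finset.mem_range, not_lt] at hk
    simp [Nat.choose_eq_zero_of_lt (show d < k by omega)]
  have hsub := (hf z).sub hfin
  rw [dist_eq_norm, ← hsub.tsum_eq]
  refine tsum_of_norm_bounded (Summable.hasSum (hbs.of_norm_bounded (hterm d))) fun k => ?_
  have : e k * z ^ k / (k.factorial : ℂ) - e k * z ^ k / (k.factorial : ℂ) * (w d k : ℂ)
      = e k * z ^ k / (k.factorial : ℂ) * ((1 - w d k : ℝ) : ℂ) := by push_cast; ring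
  rw [this, norm_mul, Complex.norm_real, Real.norm_of_nonneg (sub_nonneg.2 (hw1 d k))]
  refine mul_le_mul_of_nonneg_right ?_ (sub_nonneg.2 (hw1 d k))
  simp only [norm_div, norm_mul, norm_pow, Complex.norm_natCast, hb]
  gcongr
  exact hR' z hz

/-- The Weierstrass factor `(1 - w) * exp w` differs from `1` by a quadratic term. -/
theorem norm_weierstrassFactor_sub_one_le {w : ℂ} (hw : ‖w‖ ≤ 1) :
    ‖(1 - w) * Complex.exp w - 1‖ ≤ 3 * ‖w‖ ^ 2 := by
  have h1 := Complex.norm_exp_sub_one_sub_id_le hw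
  have h2 := Complex.norm_exp_sub_one_le hw
  have : (1 - w) * Complex.exp w - 1
      = (Complex.exp w - 1 - w) - w * (Complex.exp w - 1) := by ring
  rw [this]
  refine (norm_sub_le _ _).trans ?_
  rw [norm_mul]
  nlinarith [norm_nonneg w]

/-- Weierstrass products of genus one converge locally uniformly. -/
theorem hasProdLocallyUniformlyOn_weierstrass {ι : Type*} {ρ : ι → ℂ} {P : ℂ → ℂ}
    (hs : Summable fun k => (‖ρ k‖ ^ 2)⁻¹)
    (hP : ∀ z, HasProd (fun k => (1 - z / ρ k) * Complex.exp (z / ρ k)) (P z)) :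
    HasProdLocallyUniformlyOn (fun k z => (1 - z / ρ k) * Complex.exp (z / ρ k)) P
      Set.univ := by
  refine hasProdLocallyUniformlyOn_of_forall_compact isOpen_univ fun K _ hK => ?_
  obtain ⟨R, hR⟩ := hK.isBounded.subset_closedBall (0 : ℂ)
  have hu : Summable fun k => 3 * (R ^ 2 * (‖ρ k‖ ^ 2)⁻¹) := (hs.mul_left _).mul_left _
  have hsmall : ∀ᶠ k in cofinite, R ^ 2 * (‖ρ k‖ ^ 2)⁻¹ < 1 :=
    (hs.mul_left (R ^ 2)).tendsto_cofinite_zero.eventually_lt_const one_pos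
  have key := hu.hasProdUniformlyOn_one_add
    (f := fun k z => (1 - z / ρ k) * Complex.exp (z / ρ k) - 1) hK
    (hsmall.mono fun k hk z hz => ?_) (fun k => by fun_prop)
  · simp only [add_sub_cancel] at key
    exact key.congr_right fun z _ => (hP z).tprod_eq
  · have hzR : ‖z‖ ≤ R := mem_closedBall_zero_iff.1 (hR hz)
    have hle : ‖z / ρ k‖ ^ 2 ≤ R ^ 2 * (‖ρ k‖ ^ 2)⁻¹ := by
      rw [norm_div, div_pow, div_eq_mul_inv]
      gcongr
    refine (norm_weierstrassFactor_sub_one_le ?_).trans (by linarith)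
    exact (sq_le_one_iff₀ (norm_nonneg _)).1 (hle.trans hk.le)

/-! ### Differential operators preserving hyperbolicity -/

/-- `q' - a q` has only real zeros if `q` has only real zeros and `a` is real. -/
theorem IsHyperbolic.derivative_sub_smul {q : ℂ[X]} (hq : IsHyperbolic fun x => q.eval x)
    {a : ℂ} (ha : a.im = 0) :
    IsHyperbolic fun x => (derivative q - a • q).eval x := by
  rcases hq with hq | hq
  · have : q = 0 := Polynomial.funext fun x => by simpa using congrFun hq x
    left
    ext x
    simp [this]
  by_cases hdeg : q.natDegree = 0
  · obtain ⟨k, rfl⟩ := natDegree_eq_zero.1 hdeg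
    by_cases hak : a * k = 0
    · left
      ext x
      simp [hak]
    · right
      intro z hz
      exact absurd (by simpa [-mul_eq_zero] using hz) hak
  right
  intro z hz
  by_contra him
  have hqz : q.eval z ≠ 0 := fun h => him (hq z h)
  -- At a nonreal `z`, each term of `q' / q = ∑ 1 / (z - x)` has imaginary part of sign opposite to
  -- that of `z.im`, so the sum cannot be the real number `a`.
  have hsum := (IsAlgClosed.splits q).eval_derivative_div_eval_of_ne_zero hqz
  have hlog : q.derivative.eval z / q.eval z = a := by
    rw [div_eq_iff hqz]
    simpa [sub_eq_zero] using hz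
  rw [hlog] at hsum
  have hq0 : q ≠ 0 := fun h => hqz (by simp [h])
  have hne : q.roots ≠ 0 := by
    intro h
    have := (IsAlgClosed.splits q).natDegree_eq_card_roots
    rw [h] at this
    exact hdeg (by simpa using this)
  have him_root : ∀ x ∈ q.roots, 0 < -(1 / (z - x)).im * z.im := by
    intro x hx
    have hx0 : x.im = 0 := hq x ((mem_roots hq0).1 hx)
    have hzx : z - x ≠ 0 := fun h => him (by rw [sub_eq_zero.1 h, hx0])
    rw [one_div, Complex.inv_im, Complex.sub_im, hx0, sub_zero, neg_div, neg_neg,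
      div_mul_eq_mul_div]
    exact div_pos (mul_self_pos.2 him) (Complex.normSq_pos.2 hzx)
  have hpos : ∀ s : Multiset ℂ, s ≠ 0 → (∀ x ∈ s, 0 < -(1 / (z - x)).im * z.im) →
      0 < -((s.map fun x => 1 / (z - x)).sum).im * z.im := by
    intro s
    induction s using Multiset.induction with
    | empty => simp
    | cons x s ih =>
      intro _ hs
      have hx := hs x (Multiset.mem_cons_self x s)
      rw [Multiset.map_cons, Multiset.sum_cons, Complex.add_im]
      by_cases h0 : s = 0
      · simpa [h0] using hx
      · have := ih h0 fun y hy => hs y (Multiset.mem_cons_of_mem hy)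
        linarith
  have := hpos _ hne him_root
  rw [← hsum, ha] at this
  simp at this

/-- If `p` has only real zeros, the differential operator `p(D)` preserves hyperbolicity. -/
theorem IsHyperbolic.aeval_derivative {p q : ℂ[X]} (hp : ∀ z, p.eval z = 0 → z.im = 0)
    (hq : IsHyperbolic fun x => q.eval x) :
    IsHyperbolic fun x => (aeval (derivative : ℂ[X] →ₗ[ℂ] ℂ[X]) p q).eval x := by
  have hp0 : p ≠ 0 := by
    rintro rfl
    simpa using hp Complex.I (by simp)
  have key : ∀ s : Multiset ℂ, (∀ a ∈ s, a.im = 0) → IsHyperbolic fun x =>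
      (aeval (derivative : ℂ[X] →ₗ[ℂ] ℂ[X]) (s.map fun a => X - C a).prod q).eval x := by
    intro s
    induction s using Multiset.induction with
    | empty => simpa using hq
    | cons a s ih =>
      intro hs
      have h1 := (ih fun y hy => hs y (Multiset.mem_cons_of_mem hy)).derivative_sub_smul
        (hs a (Multiset.mem_cons_self a s))
      rw [Multiset.map_cons, Multiset.prod_cons, map_mul]
      simpa [Module.algebraMap_end_apply] using h1
  have h := key p.roots fun a ha => hp a ((mem_roots hp0).1 ha)
  rw [(IsAlgClosed.splits p).eq_prod_roots, map_mul, aeval_C]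
  simp only [Module.End.mul_apply, Module.algebraMap_end_apply, eval_smul, smul_eq_mul]
  rcases h with h | h
  · left
    ext x
    have := congrFun h x
    simp only [Pi.zero_apply] at this ⊢
    rw [this, mul_zero]
  · right
    intro z hz
    exact h z ((mul_eq_zero.1 hz).resolve_left (leadingCoeff_ne_zero.2 hp0))

theorem iteratedDeriv_polynomial_eval (p : ℂ[X]) (k : ℕ) :
    iteratedDeriv k (fun z => p.eval z) = fun z => (derivative^[k] p).eval z := by
  induction k with
  | zero => simp
  | succ k ih =>
    rw [iteratedDeriv_succ, ih, Function.iterate_succ_apply']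
    ext z
    exact Polynomial.deriv _

/-- The `j`-th derivative of `X ^ d` is `j! (d choose j) X ^ (d - j)`, and `j!` turns a coefficient
of `p` into a derivative at `0`. -/
theorem reciprocalJensen_polynomial (p : ℂ[X]) (d : ℕ) :
    reciprocalJensen d (fun z => p.eval z)
      = aeval (derivative : ℂ[X] →ₗ[ℂ] ℂ[X]) p (X ^ d) := by
  -- This range contains all of `p` and can be cut at `d + 1`; derivatives of order above `d`
  -- annihilate `X ^ d`.
  rw [aeval_eq_sum_range' (show p.natDegree < d + 1 + p.natDegree by omega),
    LinearMap.sum_apply, Finset.sum_range_add, reciprocalJensen]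
  rw [Finset.sum_eq_zero (s := Finset.range p.natDegree), add_zero]
  · refine Finset.sum_congr rfl fun j _ => ?_
    rw [LinearMap.smul_apply, Module.End.pow_apply, iterate_derivative_X_pow_eq_C_mul,
      iteratedDeriv_polynomial_eval]
    beta_reduce
    rw [← coeff_zero_eq_eval_zero, coeff_iterate_derivative,
      zero_add, smul_eq_C_mul, ← mul_assoc, ← C_mul]
    congr 2
    rw [Nat.descFactorial_self, Nat.descFactorial_eq_factorial_mul_choose, nsmul_eq_mul]
    push_cast
    ring
  · intro i _
    rw [LinearMap.smul_apply, Module.End.pow_apply, iterate_derivative_X_pow_eq_C_mul,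
      Nat.descFactorial_of_lt (by omega)]
    simp

/-! ### Limits of real-rooted polynomials -/

/-- The polynomials with only real zeros, as a multiplicative submonoid of the entire functions
with the topology of locally uniform convergence. -/
def hyperbolicPolynomials : Submonoid C(ℂ, ℂ) where
  carrier := {f | ∃ p : ℂ[X], (∀ z, p.eval z = 0 → z.im = 0) ∧ ∀ z, f z = p.eval z}
  one_mem' := ⟨1, by simp, by simp⟩
  mul_mem' := by
    rintro f g ⟨p, hp, hfp⟩ ⟨q, hq, hgq⟩
    refine ⟨p * q, fun z hz => ?_, fun z => by simp [hfp, hgq]⟩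
    rw [eval_mul] at hz
    exact (mul_eq_zero.1 hz).elim (hp z) (hq z)

theorem mem_closure_of_polynomial {f : C(ℂ, ℂ)} (p : ℂ[X]) (hp : ∀ z, p.eval z = 0 → z.im = 0)
    (hf : ∀ z, f z = p.eval z) : f ∈ hyperbolicPolynomials.topologicalClosure :=
  hyperbolicPolynomials.le_topologicalClosure ⟨p, hp, hf⟩

theorem tendsto_continuousMap_iff {ι : Type*} {l : Filter ι} {F : ι → C(ℂ, ℂ)} {f : C(ℂ, ℂ)} :
    Tendsto F l (𝓝 f) ↔ TendstoLocallyUniformlyOn (fun n z => F n z) f l Set.univ := by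
  rw [ContinuousMap.tendsto_iff_tendstoLocallyUniformly, tendstoLocallyUniformlyOn_univ]

/-- The reciprocal Jensen polynomials of a locally uniform limit of polynomials with only real
zeros are hyperbolic. -/
theorem isHyperbolic_reciprocalJensen {f : C(ℂ, ℂ)}
    (hf : f ∈ hyperbolicPolynomials.topologicalClosure) (d : ℕ) :
    IsHyperbolic fun x => (reciprocalJensen d f).eval x := by
  have hcl : f ∈ closure (hyperbolicPolynomials : Set C(ℂ, ℂ)) := hf
  have hne := mem_closure_iff_nhdsWithin_neBot.1 hcl
  set l := 𝓝[(hyperbolicPolynomials : Set C(ℂ, ℂ))] f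
  have hmem : ∀ᶠ g in l, g ∈ hyperbolicPolynomials := eventually_mem_nhdsWithin
  have hdiff : ∀ᶠ g : C(ℂ, ℂ) in l, Differentiable ℂ (g : ℂ → ℂ) := by
    filter_upwards [hmem] with g ⟨p, _, hgp⟩
    rw [show (g : ℂ → ℂ) = fun z => p.eval z from funext hgp]
    exact p.differentiable
  have hlim : TendstoLocallyUniformlyOn (fun (g : C(ℂ, ℂ)) z => g z) f l Set.univ :=
    tendsto_continuousMap_iff.1 (tendsto_id.mono_left nhdsWithin_le_nhds)
  have hcoef : ∀ j, Tendsto (fun g : C(ℂ, ℂ) => iteratedDeriv j g 0) l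
      (𝓝 (iteratedDeriv j f 0)) := fun j =>
    (tendstoLocallyUniformlyOn_iteratedDeriv hdiff hlim j).tendsto_at (Set.mem_univ 0)
  let J : C(ℂ, ℂ) → C(ℂ, ℂ) := fun g => ∑ j ∈ Finset.range (d + 1),
    ContinuousMap.const ℂ ((d.choose j : ℂ) * iteratedDeriv j g 0) * ContinuousMap.id ℂ ^ (d - j)
  have hJ : ∀ g z, J g z = (reciprocalJensen d g).eval z := fun g z => by
    simp [J, reciprocalJensen, eval_finsetSum]
  have hJlim : Tendsto J l (𝓝 (J f)) := by
    refine tendsto_finsetSum _ fun j _ => Tendsto.mul_const _ ?_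
    exact (ContinuousMap.continuous_const'.tendsto _).comp ((hcoef j).const_mul _)
  rw [← funext (hJ f)]
  refine IsHyperbolic.of_tendstoLocallyUniformlyOn ?_ ?_ (tendsto_continuousMap_iff.1 hJlim)
  · refine Eventually.of_forall fun g => ?_
    simp only [hJ]
    exact (reciprocalJensen d g).differentiable
  · filter_upwards [hmem] with g ⟨p, hp, hgp⟩
    simp only [hJ]
    rw [show (g : ℂ → ℂ) = fun z => p.eval z from funext hgp, reciprocalJensen_polynomial]
    refine IsHyperbolic.aeval_derivative hp ?_
    right
    intro z hz
    simp only [eval_pow, eval_X] at hz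
    simp [eq_zero_of_pow_eq_zero hz]

/-- `exp U` is a limit of polynomials with only real zeros if all `1 + t U` with `t ≥ 0` have
only real zeros. -/
theorem exp_mem_closure (U : ℂ[X])
    (hU : ∀ t : ℝ, 0 ≤ t → ∀ z, 1 + t * U.eval z = 0 → z.im = 0) {f : C(ℂ, ℂ)}
    (hf : ∀ z, f z = Complex.exp (U.eval z)) : f ∈ hyperbolicPolynomials.topologicalClosure := by
  have hexp : ∀ z : ℂ, HasSum (fun k : ℕ => (1 : ℂ) * z ^ k / (k.factorial : ℂ))
      (Complex.exp z) := fun z => by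
    simpa [Complex.exp_eq_exp_ℂ] using NormedSpace.expSeries_div_hasSum_exp z
  have hlim := (tendstoLocallyUniformlyOn_univ.1
    (tendstoLocallyUniformlyOn_jensen hexp)).comp (fun z => U.eval z) U.continuous
  -- `(1 + U / d) ^ d` is the `d`-th Jensen polynomial of `exp`, evaluated at `U`.
  let p : ℕ → ℂ[X] := fun d => (1 + C (((d : ℝ)⁻¹ : ℝ) : ℂ) * U) ^ d
  have hp : Tendsto (fun d => (⟨fun z => (p d).eval z, (p d).continuous⟩ : C(ℂ, ℂ))) atTop
      (𝓝 f) := by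
    rw [ContinuousMap.tendsto_iff_tendstoLocallyUniformly]
    convert! hlim using 1
    · ext d z
      simp only [ContinuousMap.coe_mk, p, eval_pow, eval_add, eval_one, eval_mul, eval_C,
        Function.comp_apply]
      rw [add_comm, add_pow]
      refine Finset.sum_congr rfl fun k _ => ?_
      simp only [one_pow, mul_one, div_eq_inv_mul]
      push_cast
      ring
    · exact funext hf
  refine mem_closure_of_tendsto hp (Eventually.of_forall fun d =>
    ⟨p d, fun z hz => ?_, fun _ => rfl⟩)
  simp only [p, eval_pow, eval_add, eval_one, eval_mul, eval_C] at hz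
  exact hU _ (by positivity) z (eq_zero_of_pow_eq_zero hz)

theorem exp_linear_mem_closure {b : ℂ} (hb : b.im = 0) {f : C(ℂ, ℂ)}
    (hf : ∀ z, f z = Complex.exp (b * z)) : f ∈ hyperbolicPolynomials.topologicalClosure := by
  refine exp_mem_closure (C b * X) (fun t _ z hz => ?_) (by simpa using hf)
  have h1 := congrArg Complex.re hz
  have h2 := congrArg Complex.im hz
  simp [hb] at h1 h2
  rcases h2 with h | h | h
  · simp [h] at h1
  · simp [h] at h1
  · exact h

theorem exp_neg_sq_mem_closure {α : ℝ} (hα : 0 ≤ α) {f : C(ℂ, ℂ)}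
    (hf : ∀ z, f z = Complex.exp (-(α : ℂ) * z ^ 2)) :
    f ∈ hyperbolicPolynomials.topologicalClosure := by
  refine exp_mem_closure (C (-(α : ℂ)) * X ^ 2) (fun t ht z hz => ?_) (by simpa using hf)
  have h1 := congrArg Complex.re hz
  have h2 := congrArg Complex.im hz
  simp [pow_two] at h1 h2
  by_contra him
  -- For nonreal `z` the imaginary part of the equation forces this; the real part then reads `1 + t
  -- α (z.im)² = 0`, which is impossible.
  have hx : t * α * z.re = 0 := by
    have : (t * α * z.re) * z.im = 0 := by
      rcases h2 with h | h | h
      · simp [h]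
      · simp [h]
      · linear_combination t * α * h / 2
    exact (mul_eq_zero.1 this).resolve_right him
  have hnn : 0 ≤ t * α * (z.im * z.im) := mul_nonneg (mul_nonneg ht hα) (mul_self_nonneg _)
  linarith [mul_eq_zero_of_left hx z.re]

/-- If `C * exp (b * x)` is real on an interval to the right of `0`, then `b` is real. -/
theorem im_eq_zero_of_mul_exp_real {C b : ℂ} (hC : C ≠ 0) {ε : ℝ} (hε : 0 < ε)
    (h : ∀ x : ℝ, 0 < x → x < ε → starRingEnd ℂ (C * Complex.exp (b * x))
      = C * Complex.exp (b * x)) : b.im = 0 := by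
  obtain ⟨x, hx0, hxε, hxb⟩ : ∃ x : ℝ, 0 < x ∧ 2 * x < ε ∧ |b.im * x| < Real.pi := by
    have h1 : ∀ᶠ x in 𝓝[>] (0 : ℝ), 2 * x < ε := by
      refine nhdsWithin_le_nhds (ContinuousAt.eventually_lt (by fun_prop) (by fun_prop) ?_)
      simpa using hε
    have h2 : ∀ᶠ x in 𝓝[>] (0 : ℝ), |b.im * x| < Real.pi := by
      refine nhdsWithin_le_nhds (ContinuousAt.eventually_lt (by fun_prop) (by fun_prop) ?_)
      simpa using Real.pi_pos
    exact (eventually_mem_nhdsWithin.and (h1.and h2)).exists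
  have e1 := h x hx0 (by linarith)
  -- Comparing `x` with `2 * x` eliminates `C` and shows that `exp (b * x)` itself is real; `|b.im *
  -- x| < π` then leaves only `b.im = 0`.
  have e2 := h (2 * x) (by linarith) hxε
  set y := Complex.exp (b * x)
  have hy : y ≠ 0 := Complex.exp_ne_zero _
  have hy2 : Complex.exp (b * ((2 * x : ℝ) : ℂ)) = y * y := by
    rw [← Complex.exp_add]
    congr 1
    push_cast
    ring
  rw [hy2] at e2
  simp only [map_mul] at e1 e2
  have hyr : starRingEnd ℂ y = y := by
    rw [← mul_assoc, e1, ← mul_assoc] at e2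
    exact mul_left_cancel₀ (mul_ne_zero hC hy) e2
  have him : y.im = 0 := Complex.conj_eq_iff_im.1 hyr
  rw [Complex.exp_im] at him
  have hs : Real.sin (b.im * x) = 0 := by
    simpa [Real.exp_ne_zero] using him
  rw [Real.sin_eq_zero_iff_of_lt_of_lt (neg_lt_of_abs_lt hxb) (lt_of_abs_lt hxb)] at hs
  exact (mul_eq_zero.1 hs).resolve_right hx0.ne'

theorem HasGenusOneStar.differentiable {F : ℂ → ℂ} (hF : HasGenusOneStar F) :
    Differentiable ℂ F := by
  obtain ⟨α, f, _, ⟨hf, _⟩, hFf⟩ := hF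
  rw [show F = fun z => Complex.exp (-(α : ℂ) * z ^ 2) * f z from funext hFf]
  fun_prop

theorem weierstrass_continuous {ι : Type*} {ρ : ι → ℂ} {P : ℂ → ℂ}
    (hs : Summable fun k => (‖ρ k‖ ^ 2)⁻¹)
    (hP : ∀ z, HasProd (fun k => (1 - z / ρ k) * Complex.exp (z / ρ k)) (P z)) :
    Continuous P := by
  have h := hasProdLocallyUniformlyOn_iff_tendstoLocallyUniformlyOn.1
    (hasProdLocallyUniformlyOn_weierstrass hs hP)
  exact (tendstoLocallyUniformlyOn_univ.1 h).continuous
    (Frequently.of_forall fun s => by fun_prop)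

theorem weierstrass_zero {ι : Type*} {ρ : ι → ℂ} {P : ℂ → ℂ}
    (hP : ∀ z, HasProd (fun k => (1 - z / ρ k) * Complex.exp (z / ρ k)) (P z)) : P 0 = 1 := by
  refine (hP 0).unique ?_
  simp

/-- A function of genus `1*` does not vanish in a punctured neighbourhood of the origin. -/
theorem HasGenusOneStar.eventually_ne_zero {F : ℂ → ℂ} (hF : HasGenusOneStar F) :
    ∀ᶠ z in 𝓝[≠] 0, F z ≠ 0 := by
  obtain ⟨α, f, _, ⟨_, C, b, m, ι, ρ, P, hC, _, hs, hP, hf⟩, hFf⟩ := hF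
  have h0 : P 0 ≠ 0 := by simp [weierstrass_zero hP]
  filter_upwards [nhdsWithin_le_nhds
    ((weierstrass_continuous hs hP).continuousAt.eventually_ne h0),
    self_mem_nhdsWithin] with z hz hz0
  have hz0' : z ≠ 0 := hz0
  simp [hFf, hf, hC, hz, hz0', Complex.exp_ne_zero]

/-- Functions in the Laguerre–Pólya class are locally uniform limits of polynomials with only
real zeros. -/
theorem IsLaguerrePolya.mem_closure {F : C(ℂ, ℂ)} (hF : IsLaguerrePolya F) :
    F ∈ hyperbolicPolynomials.topologicalClosure := by
  obtain ⟨hreal, hgenus, hhyp⟩ := hF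
  have hev := hgenus.eventually_ne_zero
  have hzero : ∀ z : ℂ, F z = 0 → z.im = 0 := by
    refine hhyp.resolve_left fun h => ?_
    obtain ⟨z, hz⟩ := hev.exists
    exact hz (congrFun h z)
  obtain ⟨α, f, hα, ⟨_, C₀, b, m, ι, ρ, P, hC, hρ, hs, hP, hf⟩, hFf⟩ := hgenus
  have hρim : ∀ k, (ρ k).im = 0 := fun k => by
    have hPk : P (ρ k) = 0 :=
      (hP (ρ k)).unique (hasProd_zero_of_exists_eq_zero ⟨k, by simp [hρ k]⟩)
    exact hzero _ (by simp [hFf, hf, hPk])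
  have hρconj : ∀ k, starRingEnd ℂ (ρ k) = ρ k := fun k => Complex.conj_eq_iff_im.2 (hρim k)
  have hPcont := weierstrass_continuous hs hP
  have hPconj : ∀ x : ℝ, starRingEnd ℂ (P x) = P x := fun x => by
    refine ((hP x).map (starRingEnd ℂ) Complex.continuous_conj).unique ?_
    convert! hP x using 1
    ext k
    simp [hρconj, ← Complex.exp_conj]
  -- Near `0` on the positive axis the other factors are real and nonzero, so dividing by them
  -- leaves `C₀ * exp (b * x)` real.
  have hb : b.im = 0 := by
    have h0 : P 0 ≠ 0 := by simp [weierstrass_zero hP]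
    obtain ⟨ε, hε, hball⟩ :=
      Metric.eventually_nhds_iff.1 (hPcont.continuousAt.eventually_ne h0)
    refine im_eq_zero_of_mul_exp_real hC hε fun x hx hxε => ?_
    have hPx : P x ≠ 0 := hball (by simpa [abs_of_pos hx] using hxε)
    have hFx := Complex.conj_eq_iff_im.2 (hreal x)
    have hw : Complex.exp (-(α : ℂ) * (x : ℂ) ^ 2) * (x : ℂ) ^ m * P x ≠ 0 :=
      mul_ne_zero (mul_ne_zero (Complex.exp_ne_zero _)
        (pow_ne_zero _ (by exact_mod_cast hx.ne'))) hPx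
    have hwc : starRingEnd ℂ (Complex.exp (-(α : ℂ) * (x : ℂ) ^ 2) * (x : ℂ) ^ m * P x)
        = Complex.exp (-(α : ℂ) * (x : ℂ) ^ 2) * (x : ℂ) ^ m * P x := by
      simp [hPconj, ← Complex.exp_conj]
    have hsplit : F x = (C₀ * Complex.exp (b * x)) *
        (Complex.exp (-(α : ℂ) * (x : ℂ) ^ 2) * (x : ℂ) ^ m * P x) := by
      rw [hFf, hf]
      ring
    rw [hsplit, map_mul, hwc] at hFx
    exact mul_right_cancel₀ hw hFx
  let E : ℂ → C(ℂ, ℂ) := fun b => ⟨fun z => Complex.exp (b * z), by fun_prop⟩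
  let G : C(ℂ, ℂ) := ⟨fun z => Complex.exp (-(α : ℂ) * z ^ 2), by fun_prop⟩
  let Q : C(ℂ, ℂ) := ⟨P, hPcont⟩
  let M : C(ℂ, ℂ) := ⟨fun z => C₀ * z ^ m, by fun_prop⟩
  let W : ι → C(ℂ, ℂ) := fun k => ⟨fun z => 1 - z / ρ k, by fun_prop⟩
  have hM : M ∈ hyperbolicPolynomials.topologicalClosure := by
    -- `C₀` need not be real: membership restricts only the zeros.
    refine mem_closure_of_polynomial (C C₀ * X ^ m) (fun z hz => ?_) (fun z => by simp [M])
    rw [eval_mul, eval_C, eval_pow, eval_X, mul_eq_zero] at hz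
    simp [eq_zero_of_pow_eq_zero (hz.resolve_left hC)]
  have hE : ∀ {b : ℂ}, b.im = 0 → E b ∈ hyperbolicPolynomials.topologicalClosure :=
    fun hb => exp_linear_mem_closure hb fun _ => rfl
  have hW : ∀ k, W k ∈ hyperbolicPolynomials.topologicalClosure := fun k => by
    refine mem_closure_of_polynomial (1 - C (ρ k)⁻¹ * X) (fun z hz => ?_)
      (fun z => by simp [W, div_eq_inv_mul])
    rw [eval_sub, eval_one, eval_mul, eval_C, eval_X, sub_eq_zero, ← div_eq_inv_mul,
      eq_div_iff (hρ k), one_mul] at hz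
    rw [← hz, hρim]
  have hQ : Q ∈ hyperbolicPolynomials.topologicalClosure := by
    have hlim : Tendsto (fun s : Finset ι => ∏ k ∈ s, W k * E (ρ k)⁻¹) atTop (𝓝 Q) := by
      rw [tendsto_continuousMap_iff]
      convert! hasProdLocallyUniformlyOn_iff_tendstoLocallyUniformlyOn.1
        (hasProdLocallyUniformlyOn_weierstrass hs hP) using 1
      ext s z
      simp [W, E, div_eq_inv_mul]
    refine hyperbolicPolynomials.isClosed_topologicalClosure.mem_of_tendsto hlim
      (Eventually.of_forall fun s => Submonoid.prod_mem _ fun k _ => mul_mem (hW k) (hE ?_))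
    rw [Complex.inv_im, hρim, neg_zero, zero_div]
  have hFeq : F = G * (M * E b * Q) := by
    ext z
    simp [G, M, E, Q, hFf, hf]
  rw [hFeq]
  exact mul_mem (exp_neg_sq_mem_closure hα fun _ => rfl) (mul_mem (mul_mem hM (hE hb)) hQ)

/-! ### Recovering the function, and products -/

/-- An entire function whose reciprocal Jensen polynomials are hyperbolic is hyperbolic. -/
theorem isHyperbolic_of_reciprocalJensen {F : ℂ → ℂ} (hF : Differentiable ℂ F)
    (h : ∀ d : ℕ, 1 ≤ d → IsHyperbolic fun x => (reciprocalJensen d F).eval x) :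
    IsHyperbolic F := by
  have hsum : ∀ z : ℂ, HasSum (fun k : ℕ => iteratedDeriv k F 0 * z ^ k / (k.factorial : ℂ))
      (F z) := fun z => by
    convert! Complex.hasSum_taylorSeries_of_entire hF 0 z using 2 with k
    simp only [sub_zero, smul_eq_mul]
    ring
  refine IsHyperbolic.of_tendstoLocallyUniformlyOn (Eventually.of_forall fun d => by fun_prop) ?_
    (tendstoLocallyUniformlyOn_jensen hsum)
  filter_upwards [eventually_ge_atTop 1] with d hd
  have hd0 : (d : ℂ) ≠ 0 := by exact_mod_cast (by omega : d ≠ 0)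
  -- The substitution `z ↦ d / z` preserves reality, and the excluded point `0` is real.
  have hrev : ∀ z : ℂ, z ≠ 0 →
      ∑ k ∈ Finset.range (d + 1), (d.choose k : ℂ) * iteratedDeriv k F 0 * (z / d) ^ k
        = (z / d) ^ d * (reciprocalJensen d F).eval (d / z) := fun z hz => by
    rw [reciprocalJensen, eval_finsetSum, Finset.mul_sum]
    refine Finset.sum_congr rfl fun k hk => ?_
    have hkd : k ≤ d := by simpa [Nat.lt_succ_iff] using hk
    have hzd : z / d ≠ 0 := div_ne_zero hz hd0
    rw [eval_mul, eval_C, eval_pow, eval_X, ← inv_div z (d : ℂ), inv_pow,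
      mul_left_comm ((z / d) ^ d), ← pow_sub₀ _ hzd (Nat.sub_le d k), Nat.sub_sub_self hkd]
  rcases h d hd with h0 | hz
  · left
    have hp : reciprocalJensen d F = 0 := Polynomial.funext fun x => by simpa using congrFun h0 x
    have hcoef : ∀ k ≤ d, (d.choose k : ℂ) * iteratedDeriv k F 0 = 0 := fun k hk => by
      have := congrArg (fun p => p.coeff (d - k)) hp
      simp only [reciprocalJensen, finsetSum_coeff, coeff_C_mul_X_pow, coeff_zero] at this
      rw [Finset.sum_eq_single_of_mem k (Finset.mem_range.2 (by omega))] at this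
      · simpa using this
      · intro j hj hjk
        rw [Finset.mem_range] at hj
        exact if_neg (by omega)
    ext z
    exact Finset.sum_eq_zero fun k hk => by
      rw [hcoef k (by simpa [Nat.lt_succ_iff] using hk), zero_mul]
  · right
    intro z hz0
    by_cases hzz : z = 0
    · simp [hzz]
    beta_reduce at hz0
    rw [hrev z hzz, mul_eq_zero] at hz0
    have := hz _ (hz0.resolve_left (pow_ne_zero _ (div_ne_zero hzz hd0)))
    rw [Complex.div_im] at this
    have hn : Complex.normSq z ≠ 0 := by simpa using hzz
    simp at this
    have hdn : d ≠ 0 := by omega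
    tauto

theorem iteratedDeriv_zero_eq_of_hasSum {f : ℂ → ℂ} {c : ℕ → ℂ}
    (hc : ∀ z : ℂ, HasSum (fun j : ℕ => c j * z ^ j / (j.factorial : ℂ)) (f z)) (k : ℕ) :
    iteratedDeriv k f 0 = c k := by
  have h1 : HasFPowerSeriesAt f
      (FormalMultilinearSeries.ofScalars ℂ fun j => c j / (j.factorial : ℂ)) 0 := by
    rw [hasFPowerSeriesAt_iff]
    refine Eventually.of_forall fun z => ?_
    rw [zero_add]
    convert! hc z using 2 with j
    rw [FormalMultilinearSeries.coeff_ofScalars, smul_eq_mul]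
    ring
  have h2 := congrArg (fun p => p.coeff k)
    (h1.analyticAt.hasFPowerSeriesAt.eq_formalMultilinearSeries h1)
  simp only [FormalMultilinearSeries.coeff_ofScalars] at h2
  exact (div_left_inj' (Nat.cast_ne_zero.2 k.factorial_ne_zero)).1 h2

/-- Reciprocal Jensen polynomials of a product. -/
theorem sum_reciprocalJensen_eq {F G : ℂ → ℂ} (hF : Differentiable ℂ F)
    (hG : Differentiable ℂ G) (d : ℕ) :
    ∑ j ∈ Finset.range (d + 1),
      C ((d.choose j : ℂ) * iteratedDeriv j F 0) * reciprocalJensen (d - j) G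
      = reciprocalJensen d (F * G) := by
  have hmul : ∀ k, iteratedDeriv k (F * G) 0 = ∑ i ∈ Finset.range (k + 1),
      (k.choose i : ℂ) * iteratedDeriv i F 0 * iteratedDeriv (k - i) G 0 := fun k =>
    iteratedDeriv_mul hF.contDiff.contDiffAt hG.contDiff.contDiffAt
  -- Both sides are sums over `i + j ≤ d`; the coefficients agree by `(d choose k)(k choose i) = (d
  -- choose i)(d - i choose k - i)`.
  have hflip := Finset.sum_range_diag_flip (d + 1) fun i j : ℕ =>
    C ((d.choose i : ℂ) * iteratedDeriv i F 0 * (((d - i).choose j : ℂ) * iteratedDeriv j G 0))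
      * X ^ (d - i - j)
  rw [reciprocalJensen]
  trans
  swap
  · trans
    · exact hflip.symm
    · refine Finset.sum_congr rfl fun k hk => ?_
      rw [hmul, Finset.mul_sum, map_sum, Finset.sum_mul]
      refine Finset.sum_congr rfl fun i hi => ?_
      have hik : i ≤ k := by simpa [Nat.lt_succ_iff] using hi
      have hch : (d.choose k : ℂ) * k.choose i = d.choose i * (d - i).choose (k - i) := by
        exact_mod_cast Nat.choose_mul hik
      rw [show d - i - (k - i) = d - k by omega]
      congr 2
      linear_combination -(iteratedDeriv i F 0 * iteratedDeriv (k - i) G 0) * hch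
  · refine Finset.sum_congr rfl fun j hj => ?_
    have hjd : j ≤ d := by simpa [Nat.lt_succ_iff] using hj
    rw [reciprocalJensen, Finset.mul_sum, show d + 1 - j = d - j + 1 by omega]
    refine Finset.sum_congr rfl fun i _ => ?_
    rw [← mul_assoc, ← C_mul]

end LaguerrePolya

theorem theorem3p5 (Φ Ω : ℂ → ℂ) (c : ℕ → ℂ)
    (hc : ∀ z : ℂ, HasSum (fun j : ℕ => c j * z ^ j / (j.factorial : ℂ)) (Φ z))
    (hreal : LaguerrePolya.IsReal Φ)
    (hgenus : LaguerrePolya.HasGenusOneStar Φ)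
    (hΩ : LaguerrePolya.IsLaguerrePolya Ω) :
    LaguerrePolya.IsHyperbolic Φ ↔
      ∀ d : ℕ, 1 ≤ d → LaguerrePolya.IsHyperbolic (fun x : ℂ =>
        (∑ j ∈ Finset.range (d + 1),
          Polynomial.C ((d.choose j : ℂ) * c j) *
            LaguerrePolya.reciprocalJensen (d - j) Ω).eval x) := by
  have hΦd := hgenus.differentiable
  have hΩd := hΩ.2.1.differentiable
  have hsum : ∀ d, ∑ j ∈ Finset.range (d + 1), Polynomial.C ((d.choose j : ℂ) * c j) *
      LaguerrePolya.reciprocalJensen (d - j) Ω = LaguerrePolya.reciprocalJensen d (Φ * Ω) :=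
    fun d => by
      rw [← LaguerrePolya.sum_reciprocalJensen_eq hΦd hΩd]
      simp only [LaguerrePolya.iteratedDeriv_zero_eq_of_hasSum hc]
  simp only [hsum]
  constructor
  · intro hhyp d _
    let f : C(ℂ, ℂ) := ⟨Φ, hΦd.continuous⟩
    let g : C(ℂ, ℂ) := ⟨Ω, hΩd.continuous⟩
    have hf : LaguerrePolya.IsLaguerrePolya f := ⟨hreal, hgenus, hhyp⟩
    have hg : LaguerrePolya.IsLaguerrePolya g := hΩ
    exact LaguerrePolya.isHyperbolic_reciprocalJensen (mul_mem hf.mem_closure hg.mem_closure) d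
  · intro h
    rcases LaguerrePolya.isHyperbolic_of_reciprocalJensen (hΦd.mul hΩd) h with h0 | h0
    -- Neither factor vanishes near `0` off the origin, so the product is not identically zero.
    · obtain ⟨z, hz1, hz2⟩ := (hgenus.eventually_ne_zero.and hΩ.2.1.eventually_ne_zero).exists
      exact absurd (congrFun h0 z) (mul_ne_zero hz1 hz2)
    · right
      intro z hz
      exact h0 z (by simp [hz])
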